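/- Let $k$ be an algebraically closed field. A variety over $k$ is a reduced, separated, possibly reducible, scheme of finite type over $k$; morphisms of varieties are $k$-morphisms, and a point of a variety is a closed point. Let $Y$, $S$ and $P$ be varieties over $k$ and let $d\geq 1$ be an integer. Let $h\colon Y\to S$ be a smooth morphism all of whose nonempty fibers $h^{-1}(s)$ are irreducible of dimension $d$, and let $P\to S$ be a proper morphism. Let $U$ be an open subset of $Y$ such that $U\cap h^{-1}(s)\neq\emptyset$ for every $s\in h(Y)$. Let $\varphi\colon U\to P$ be an $S$-morphism, let $\Gamma\subset U\times_S P$ be its graph, and let $X=\overline{\Gamma}$ be the closure of $\Gamma$ in $Y\times_S P$. Suppose that the projection $f\colon X\to Y$ has the property that $f^{-1}(y)$ is a finite set for every $y\in Y\setminus U$. Then $\varphi$ has a unique extension to $Y$: there is a unique $S$-morphism $\tilde\varphi\colon Y\to P$ such that $\tilde\varphi|_U=\varphi$. -/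

import Mathlib

open AlgebraicGeometry CategoryTheory CategoryTheory.Limits

universe u

/-- `X`, with structure morphism `π : X ⟶ Spec k`, is a variety over the field `k`: a reduced,
separated, possibly reducible, scheme of finite type over `k`. -/
structure IsVariety (k : Type u) [Field k] (X : Scheme.{u}) (π : X ⟶ Spec (CommRingCat.of k)) :
    Prop where
  isReduced : IsReduced X
  isSeparated : IsSeparated π
  locallyOfFiniteType : LocallyOfFiniteType π
  quasiCompact : QuasiCompact π

/-- The graph morphism `(ι, φ) : U ⟶ Y ×_S P` of an `S`-morphism `φ : U ⟶ P` defined on an open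
subset `U` of the `S`-scheme `Y`. -/
noncomputable def graphHom {Y S P : Scheme.{u}} (h : Y ⟶ S) (p : P ⟶ S) (U : Y.Opens)
    (φ : (U : Scheme.{u}) ⟶ P) (hφ : φ ≫ p = U.ι ≫ h) : (U : Scheme.{u}) ⟶ pullback h p :=
  pullback.lift U.ι φ hφ.symm

/-- The closure in `Y ×_S P` of the graph of the `S`-morphism `φ : U ⟶ P`, as a closed subset. -/
def graphClosure {Y S P : Scheme.{u}} (h : Y ⟶ S) (p : P ⟶ S) (U : Y.Opens)
    (φ : (U : Scheme.{u}) ⟶ P) (hφ : φ ≫ p = U.ι ≫ h) : Set ↥(pullback h p) :=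
  closure (Set.range (graphHom h p U φ hφ))

/-! Uniqueness: `U` is dense in the reduced scheme `Y`, and `P` is separated over `S`. Density also
lets local extensions be glued, so existence is local at a closed point `y` outside `U`.

The map `f` is proper with finite fibre over `y`, hence finite over a neighbourhood of `y`. In
affine terms there are `A` (base), `B` smooth over `A`, `C` finite over `B`, and the maximal ideal
`p` of `h y`. Since the fibre of `h` through `y` is irreducible and meets `U`, some `x` in `B` has
its basic open inside `U` and is not identically zero on that fibre. The graph gives a `B`-algebra
map `C → B[1/x]` with image integral over `B`. It suffices to make this image land in `B[1/t]` for
some `t` with `t - 1 ∈ pB`, because such a `t` does not vanish at `y`.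

This is `exists_smul_mem_range_of_isIntegral`. `B` need not be normal, as `A` is only reduced, but
it is normal over the generic points of `A`. So an integral fraction `b / x ^ n` satisfies `a * b =
x ^ n * c` for a nonzerodivisor `a` of `A`. The fibre ring `B / pB` is a domain in which `x` is
nonzero (`mem_map_of_mul_mem_of_isIrreducible`). Flatness then makes `x` regular modulo `a` near the
fibre (`exists_mul_mem_span_algebraMap`), so `a` divides `c` there and cancels. -/

/-! ### Flat algebras: regularity spreads out from a fibre -/

open TensorProduct in
/-- Multiplication by `x` is injective on `B ⊗[A] M` for a vector space `M` over a field `κ` if it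
is injective on `B ⊗[A] κ`. -/
lemma tensor_smul_injective_of_field {A B κ M : Type*} [CommRing A] [CommRing B] [Algebra A B]
    [Field κ] [Algebra A κ] [AddCommGroup M] [Module A M] [Module κ M] [IsScalarTower A κ M]
    (x : B) (hx : ∀ u : B ⊗[A] κ, x • u = 0 → u = 0) (u : B ⊗[A] M) (hu : x • u = 0) : u = 0 := by
  let m : κ ⊗[A] B →ₗ[κ] κ ⊗[A] B := (LinearMap.mulLeft A x).baseChange κ
  have hm : Function.Injective m := by
    rw [← LinearMap.ker_eq_bot, LinearMap.ker_eq_bot']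
    intro v hv
    have key : ∀ w : κ ⊗[A] B,
        TensorProduct.comm A κ B (m w) = x • TensorProduct.comm A κ B w := by
      intro w
      induction w with
      | zero => simp
      | add a b ha hb => simp [ha, hb]
      | tmul a b => simp [m, TensorProduct.smul_tmul']
    have := hx (TensorProduct.comm A κ B v) (by rw [← key, hv, map_zero])
    simpa using this
  -- `M` is flat over the field `κ`, and `B ⊗[A] M` is `M ⊗[κ] (κ ⊗[A] B)`.
  have h2 := Module.Flat.lTensor_preserves_injective_linearMap (M := M) m hm
  let e : M ⊗[κ] (κ ⊗[A] B) ≃ₗ[κ] M ⊗[A] B := AlgebraTensorModule.cancelBaseChange A κ κ M B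
  have key : ∀ w : M ⊗[κ] (κ ⊗[A] B), TensorProduct.comm A M B (e (m.lTensor M w)) =
      x • TensorProduct.comm A M B (e w) := by
    intro w
    induction w with
    | zero => simp
    | add a b ha hb => simp only [map_add, smul_add, ha, hb]
    | tmul a b =>
      induction b with
      | zero => simp
      | add c d hc hd => simp only [map_add, smul_add, hc, hd, tmul_add]
      | tmul c d => simp [m, e, TensorProduct.smul_tmul']
  obtain ⟨w, rfl⟩ := (TensorProduct.comm A M B).surjective u
  obtain ⟨w, rfl⟩ := e.surjective w
  rw [← key] at hu
  have h3 : m.lTensor M w = 0 := by simpa using hu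
  rw [(map_eq_zero_iff _ h2).mp h3]; simp

open TensorProduct in
lemma lTensor_smul_left {A B M N : Type*} [CommRing A] [CommRing B] [Algebra A B]
    [AddCommGroup M] [Module A M] [AddCommGroup N] [Module A N] (f : M →ₗ[A] N) (x : B)
    (u : B ⊗[A] M) : f.lTensor B (x • u) = x • f.lTensor B u :=
  (AlgebraTensorModule.lTensor B B f).map_smul x u

open TensorProduct in
/-- If `x` is regular on the fibre `B / pB` of a flat algebra `B`, then `x` is regular on `B ⊗ M`
for every module `M` killed by a power of `p`. -/
lemma tensor_smul_injective_of_pow_smul_eq_bot {A B : Type*} [CommRing A] [CommRing B] [Algebra A B]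
    [Module.Flat A B] (p : Ideal A) [p.IsMaximal] (x : B)
    (hx : ∀ b, x * b ∈ p.map (algebraMap A B) → b ∈ p.map (algebraMap A B)) (n : ℕ) :
    ∀ {M : Type*} [AddCommGroup M] [Module A M], p ^ n • (⊤ : Submodule A M) = ⊥ →
      ∀ u : B ⊗[A] M, x • u = 0 → u = 0 := by
  induction n with
  | zero =>
    intro M _ _ hM u _
    have : Subsingleton M := by
      rw [← Submodule.subsingleton_iff A, ← subsingleton_iff_bot_eq_top]
      simpa using hM.symm
    exact Subsingleton.elim _ _
  | succ n ih =>
    intro M _ _ hM u hu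
    -- Dévissage along `0 → pM → M → M/pM → 0`: the quotient is a vector space over `A ⧸ p`, and
    -- `pM` is killed by `p ^ n`.
    let N : Submodule A M := p • ⊤
    let _ := Ideal.Quotient.field p
    have hx' : ∀ u : B ⊗[A] (A ⧸ p), x • u = 0 → u = 0 := by
      intro u hu
      obtain ⟨v, rfl⟩ := (Algebra.TensorProduct.quotIdealMapEquivTensorQuot B p).surjective u
      obtain ⟨b, rfl⟩ := Ideal.Quotient.mk_surjective v
      rw [← map_smul, EmbeddingLike.map_eq_zero_iff, Algebra.smul_def,
        Ideal.Quotient.algebraMap_eq, ← map_mul, Ideal.Quotient.eq_zero_iff_mem] at hu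
      rw [Ideal.Quotient.eq_zero_iff_mem.mpr (hx b hu), map_zero]
    have ht : Module.IsTorsionBySet A (M ⧸ N) p := Module.isTorsionBySet_quotient_ideal_smul M p
    let _ : Module (A ⧸ p) (M ⧸ N) := ht.module
    have : IsScalarTower A (A ⧸ p) (M ⧸ N) := ht.isScalarTower
    have h1 : N.mkQ.lTensor B u = 0 := by
      apply tensor_smul_injective_of_field (κ := A ⧸ p) x hx'
      rw [← lTensor_smul_left, hu, map_zero]
    obtain ⟨v, rfl⟩ := (lTensor_exact B (LinearMap.exact_subtype_mkQ N) N.mkQ_surjective u).mp h1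
    have hv : x • v = 0 := by
      apply Module.Flat.lTensor_preserves_injective_linearMap (M := B) N.subtype N.subtype_injective
      rw [lTensor_smul_left, hu, map_zero]
    refine (congrArg (N.subtype.lTensor B) (ih (M := N) ?_ v hv)).trans (map_zero _)
    apply Submodule.map_injective_of_injective N.subtype_injective
    rw [Submodule.map_smul'', Submodule.map_top, Submodule.range_subtype, Submodule.map_bot,
      ← hM, pow_succ, mul_smul]

open TensorProduct in
/-- If `x` is regular on the fibre `B / pB` of a flat algebra `B`, then `x` is regular on `B ⊗ M`
in a neighbourhood of that fibre. -/
lemma exists_smul_eq_self_of_smul_eq_zero {A B M : Type*} [CommRing A] [CommRing B]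
    [Algebra A B] [Module.Flat A B] [IsNoetherianRing B] (p : Ideal A) [p.IsMaximal]
    (x : B) (hx : ∀ b, x * b ∈ p.map (algebraMap A B) → b ∈ p.map (algebraMap A B))
    [AddCommGroup M] [Module A M] [Module.Finite A M] (u : B ⊗[A] M) (hu : x • u = 0) :
    ∃ r ∈ p.map (algebraMap A B), r • u = u := by
  -- Krull's intersection theorem. Membership at level `n` is the previous lemma for `M ⧸ p ^ n M`.
  suffices h : u ∈ ⨅ i : ℕ, p.map (algebraMap A B) ^ i • (⊤ : Submodule B (B ⊗[A] M)) by
    obtain ⟨r, hr⟩ := (Ideal.mem_iInf_smul_pow_eq_bot_iff _ u).mp h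
    exact ⟨r, r.2, hr⟩
  rw [Submodule.mem_iInf]
  intro n
  let N : Submodule A M := p ^ n • ⊤
  have h1 : N.mkQ.lTensor B u = 0 := by
    refine tensor_smul_injective_of_pow_smul_eq_bot p x hx n (M := M ⧸ N) ?_ _
      (by rw [← lTensor_smul_left, hu, map_zero])
    rw [eq_bot_iff, Submodule.smul_le]
    exact fun r hr m _ ↦ Module.isTorsionBySet_quotient_ideal_smul M (p ^ n) (x := m) (a := ⟨r, hr⟩)
  obtain ⟨v, rfl⟩ := (lTensor_exact B (LinearMap.exact_subtype_mkQ N) N.mkQ_surjective u).mp h1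
  rw [← Ideal.map_pow]
  clear hu h1
  induction v with
  | zero => simp
  | add a b ha hb => rw [map_add]; exact add_mem ha hb
  | tmul b m =>
    obtain ⟨m, hm⟩ := m
    simp only [LinearMap.lTensor_tmul, Submodule.subtype_apply]
    induction hm using Submodule.smul_induction_on' with
    | smul r hr m _ =>
      rw [tmul_smul, ← algebraMap_smul B r]
      exact Submodule.smul_mem_smul (Ideal.mem_map_of_mem _ hr) trivial
    | add m _ m' _ h h' => rw [tmul_add]; exact add_mem h h'

/-- If `x` is regular on the fibre `B / pB` of a flat algebra `B`, then `x` is regular on `B / aB`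
in a neighbourhood of that fibre. -/
lemma exists_mul_mem_span_algebraMap {A B : Type*} [CommRing A] [CommRing B]
    [Algebra A B] [Module.Flat A B] [IsNoetherianRing B] (p : Ideal A) [p.IsMaximal]
    (x : B) (hx : ∀ b, x * b ∈ p.map (algebraMap A B) → b ∈ p.map (algebraMap A B))
    (a : A) (b : B) (hb : algebraMap A B a ∣ x * b) :
    ∃ r ∈ p.map (algebraMap A B), algebraMap A B a ∣ (1 - r) * b := by
  let e := Algebra.TensorProduct.quotIdealMapEquivTensorQuot B (Ideal.span {a})
  have hm (b : B) : Ideal.Quotient.mk ((Ideal.span {a}).map (algebraMap A B)) b = 0 ↔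
      algebraMap A B a ∣ b := by
    rw [Ideal.Quotient.eq_zero_iff_mem, Ideal.map_span, Set.image_singleton,
      Ideal.mem_span_singleton]
  have hs (c b : B) : c • e (Ideal.Quotient.mk _ b) = e (Ideal.Quotient.mk _ (c * b)) := by
    rw [← map_smul, Algebra.smul_def, Ideal.Quotient.algebraMap_eq, ← map_mul]
  obtain ⟨r, hr, h⟩ := exists_smul_eq_self_of_smul_eq_zero p x hx (e (Ideal.Quotient.mk _ b))
    (by rw [hs, (hm _).mpr hb, map_zero])
  refine ⟨r, hr, (hm _).mp ?_⟩
  rw [hs, e.injective.eq_iff, ← sub_eq_zero, ← map_sub] at h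
  rw [← neg_eq_zero, ← map_neg, ← h]
  congr 1; ring

/-! ### Integral fractions and normality of smooth algebras over a field -/

/-- The fraction `b / x` is a root of a monic polynomial over `R`. -/
def IsIntegralFraction {R : Type*} [CommRing R] (x b : R) : Prop :=
  ∃ p : Polynomial R, p.Monic ∧ (p.scaleRoots x).eval b = 0

/-- Clearing denominators with `scaleRoots` keeps the condition inside the ring, so it survives any
ring map, even one that does not preserve the regularity of `x`. -/
lemma IsIntegralFraction.map {R T : Type*} [CommRing R] [CommRing T] {x b : R}
    (h : IsIntegralFraction x b) (f : R →+* T) : IsIntegralFraction (f x) (f b) := by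
  obtain ⟨p, hp, h⟩ := h
  cases subsingleton_or_nontrivial T
  · exact ⟨1, Polynomial.monic_one, Subsingleton.elim _ _⟩
  refine ⟨p.map f, hp.map f, ?_⟩
  rw [← Polynomial.map_scaleRoots _ _ _ (by simp [hp.leadingCoeff]), Polynomial.eval_map,
    Polynomial.eval₂_hom, h, map_zero]

lemma IsIntegralFraction.of_isIntegral {R T : Type*} [CommRing R] [CommRing T] [Algebra R T]
    (hRT : Function.Injective (algebraMap R T)) {x b : R} {c : T} (hc : IsIntegral R c)
    (h : algebraMap R T x * c = algebraMap R T b) : IsIntegralFraction x b := by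
  obtain ⟨p, hp, hpc⟩ := hc
  refine ⟨p, hp, hRT ?_⟩
  rw [map_zero, ← Polynomial.eval₂_hom, ← h]
  exact Polynomial.scaleRoots_eval₂_eq_zero _ hpc

lemma IsIntegralFraction.isIntegral {R T : Type*} [CommRing R] [CommRing T] [Algebra R T]
    {x b : R} {c : T} (h : IsIntegralFraction x b) (hx : IsUnit (algebraMap R T x))
    (hc : algebraMap R T x * c = algebraMap R T b) : IsIntegral R c := by
  obtain ⟨p, hp, h⟩ := h
  refine ⟨p, hp, (hx.pow p.natDegree).mul_right_eq_zero.mp ?_⟩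
  rw [← Polynomial.scaleRoots_eval₂_mul, hc, Polynomial.eval₂_hom, h, map_zero]

-- Over the fraction field `L` of `D`, the étale algebra becomes finite and reduced, hence Artinian,
-- so nonzerodivisors become units and `b / x` exists there. Integral closure commutes with smooth
-- base change and `D` is integrally closed, so `b / x` already lies in `R`.
open TensorProduct nonZeroDivisors in
lemma isReduced_and_dvd_of_isIntegralFraction_of_etale (D R : Type*) [CommRing D] [IsDomain D]
    [IsIntegrallyClosed D] [CommRing R] [Algebra D R] [Algebra.Etale D R] :
    IsReduced R ∧ ∀ x ∈ R⁰, ∀ b : R, IsIntegralFraction x b → x ∣ b := by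
  let L := FractionRing D
  have : Algebra.EssFiniteType L (L ⊗[D] R) := inferInstance
  have : Module.Finite L (L ⊗[D] R) := Algebra.FormallyUnramified.finite_of_free _ _
  have : IsReduced (L ⊗[D] R) := Algebra.FormallyUnramified.isReduced_of_field L _
  have : IsReduced (R ⊗[D] L) :=
    isReduced_of_injective (Algebra.TensorProduct.comm D R L)
      (Algebra.TensorProduct.comm D R L).injective
  have hA' : IsArtinianRing (L ⊗[D] R) := IsArtinianRing.of_finite L _
  have hA : IsArtinianRing (R ⊗[D] L) :=
    (Algebra.TensorProduct.comm D L R).surjective.isArtinianRing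
      (f := (Algebra.TensorProduct.comm D L R).toRingHom)
  have hinj : Function.Injective (algebraMap R (R ⊗[D] L)) :=
    Algebra.TensorProduct.includeLeft_injective (S := R) (IsFractionRing.injective D L)
  refine ⟨isReduced_of_injective _ hinj, fun x hx b hb ↦ ?_⟩
  have hxu : IsUnit (algebraMap R (R ⊗[D] L) x) := by
    apply IsArtinianRing.isUnit_of_mem_nonZeroDivisors
    exact IsLocalization.map_nonZeroDivisors_le (Algebra.algebraMapSubmonoid R D⁰) _
      (Submonoid.mem_map_of_mem _ hx)
  obtain ⟨c, hc⟩ := hxu.dvd (a := algebraMap R (R ⊗[D] L) b)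
  have hci := hb.isIntegral hxu hc.symm
  obtain ⟨w, hw⟩ := (TensorProduct.toIntegralClosure_bijective_of_smooth (R := D) (S := R)
    (B := L)).2 ⟨c, hci⟩
  have key : ∀ w : R ⊗[D] integralClosure D L,
      ((TensorProduct.toIntegralClosure D R L w : integralClosure R (R ⊗[D] L)) : R ⊗[D] L) ∈
        (algebraMap R (R ⊗[D] L)).range := by
    intro w
    induction w with
    | zero => simp
    | add a b ha hb => rw [map_add]; exact add_mem ha hb
    | tmul r z =>
      obtain ⟨z, hz⟩ := z
      obtain ⟨d, rfl⟩ := IsIntegrallyClosed.isIntegral_iff.mp hz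
      refine ⟨r * algebraMap D R d, ?_⟩
      have : (TensorProduct.toIntegralClosure D R L (r ⊗ₜ ⟨algebraMap D L d, hz⟩)).1 =
          r ⊗ₜ algebraMap D L d := rfl
      rw [this, Algebra.TensorProduct.algebraMap_apply, Algebra.algebraMap_self_apply,
        Algebra.algebraMap_eq_smul_one, Algebra.algebraMap_eq_smul_one, mul_smul_comm, mul_one,
        TensorProduct.smul_tmul]
  obtain ⟨r, hr⟩ := key w
  refine ⟨r, hinj ?_⟩
  rw [map_mul, hr, hw, hc]

open nonZeroDivisors in
/-- A smooth algebra over a field is reduced and integrally closed in its localizations at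
nonzerodivisors. -/
lemma isReduced_and_dvd_of_isIntegralFraction_of_smooth (K R : Type*) [Field K] [CommRing R]
    [Algebra K R] [Algebra.Smooth K R] :
    IsReduced R ∧ ∀ x ∈ R⁰, ∀ b : R, IsIntegralFraction x b → x ∣ b := by
  -- Locally a smooth algebra is étale over a polynomial ring, which is integrally closed. Both
  -- claims are then local: a proper annihilator or colon ideal would lie in some maximal `m`, yet
  -- contain a power of `f`.
  have key (m : Ideal R) [m.IsPrime] : ∃ f ∉ m, IsReduced (Localization.Away f) ∧
      ∀ x ∈ (Localization.Away f)⁰, ∀ b, IsIntegralFraction x b → x ∣ b := by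
    obtain ⟨f, hfm, n, _, _, _⟩ :=
      Algebra.IsSmoothAt.exists_isStandardEtale_mvPolynomial (R := K) (p := m)
    exact ⟨f, hfm, isReduced_and_dvd_of_isIntegralFraction_of_etale (MvPolynomial (Fin n) K) _⟩
  constructor
  · constructor
    intro r hr
    by_contra h0
    have hne : Ideal.span {r} ≠ ⊥ := by simpa
    obtain ⟨m, hm, hle⟩ := Ideal.exists_le_maximal ((⊥ : Ideal R).colon {r})
      (by rw [Ne, Ideal.eq_top_iff_one, Submodule.mem_colon_singleton]; simpa)
    obtain ⟨f, hf, _, -⟩ := key m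
    have h1 : algebraMap R (Localization.Away f) r = 0 := (hr.map _).eq_zero
    obtain ⟨⟨_, k, rfl⟩, hk⟩ :=
      (IsLocalization.map_eq_zero_iff (Submonoid.powers f) _ r).mp h1
    refine hf (hm.isPrime.mem_of_pow_mem k (hle ?_))
    rw [Submodule.mem_colon_singleton]
    simpa using hk
  · intro x hx b hb
    by_contra h0
    obtain ⟨m, hm, hle⟩ := Ideal.exists_le_maximal ((Ideal.span {x}).colon {b})
      (by rw [Ne, Ideal.eq_top_iff_one, Submodule.mem_colon_singleton]
          simpa [Ideal.mem_span_singleton])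
    obtain ⟨f, hf, -, h⟩ := key m
    obtain ⟨c, hc⟩ := h _ (IsLocalization.map_nonZeroDivisors_le (Submonoid.powers f) _
      (Submonoid.mem_map_of_mem _ hx)) _ (hb.map (algebraMap R (Localization.Away f)))
    obtain ⟨⟨c, _, k, rfl⟩, rfl⟩ := IsLocalization.mk'_surjective (Submonoid.powers f) c
    rw [IsLocalization.mul_mk'_eq_mk'_of_mul, eq_comm, IsLocalization.mk'_eq_iff_eq_mul,
      ← map_mul, IsLocalization.eq_iff_exists (Submonoid.powers f)] at hc
    obtain ⟨⟨_, l, rfl⟩, hl⟩ := hc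
    refine hf (hm.isPrime.mem_of_pow_mem (l + k) (hle ?_))
    rw [Submodule.mem_colon_singleton, Ideal.mem_span_singleton, smul_eq_mul, pow_add]
    exact ⟨f ^ l * c, by linear_combination -hl⟩

/-! ### Integral fractions in a smooth algebra over a reduced base -/

-- A reduced ring localizes to a field at a minimal prime, so the case of a field base applies; `a`
-- is the denominator that this introduces.
open TensorProduct nonZeroDivisors in
lemma exists_notMem_dvd_mul_of_isIntegralFraction {A B : Type*} [CommRing A] [IsReduced A]
    [CommRing B] [Algebra A B] [Algebra.Smooth A B] (η : Ideal A) (hη : η ∈ minimalPrimes A)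
    (x b : B) (hx : x ∈ B⁰) (hb : IsIntegralFraction x b) :
    ∃ a ∉ η, x ∣ algebraMap A B a * b := by
  have := hη.1.1
  have : Ring.KrullDimLE 0 (Localization.AtPrime η) := .of_isLocalization _ hη _
  let _ : Field (Localization.AtPrime η) := Ring.KrullDimLE.isField_of_isReduced.toField
  let S := Algebra.algebraMapSubmonoid B η.primeCompl
  let f := (Algebra.TensorProduct.includeRight :
    B →ₐ[A] Localization.AtPrime η ⊗[A] B).toRingHom
  let _ : Algebra B (Localization.AtPrime η ⊗[A] B) := f.toAlgebra
  have : IsLocalization S (Localization.AtPrime η ⊗[A] B) :=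
    IsLocalization.tensorRight (Localization.AtPrime η) η.primeCompl
  obtain ⟨c, hc⟩ := (isReduced_and_dvd_of_isIntegralFraction_of_smooth (Localization.AtPrime η)
    (Localization.AtPrime η ⊗[A] B)).2 _ (IsLocalization.map_nonZeroDivisors_le S _
      (Submonoid.mem_map_of_mem _ hx)) _ (hb.map (algebraMap B _))
  obtain ⟨⟨c, s⟩, rfl⟩ := IsLocalization.mk'_surjective S c
  rw [IsLocalization.mul_mk'_eq_mk'_of_mul, eq_comm, IsLocalization.mk'_eq_iff_eq_mul,
    ← map_mul, IsLocalization.eq_iff_exists S] at hc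
  obtain ⟨⟨_, l, hl, rfl⟩, h⟩ := hc
  obtain ⟨_, k, hk, rfl⟩ := s
  refine ⟨l * k, η.primeCompl.mul_mem hl hk, algebraMap A B l * c, ?_⟩
  rw [map_mul]
  linear_combination -h

-- Prime avoidance: the zero divisors of a reduced Noetherian ring form the union of its finitely
-- many minimal primes.
open nonZeroDivisors in
lemma exists_mem_nonZeroDivisors_of_forall_minimalPrimes {A : Type*} [CommRing A] [IsReduced A]
    [IsNoetherianRing A] (I : Ideal A) (hI : ∀ η ∈ minimalPrimes A, ∃ a ∉ η, a ∈ I) :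
    ∃ a ∈ A⁰, a ∈ I := by
  by_contra! h
  have hfin := Ideal.finite_minimalPrimes_of_isNoetherianRing A ⊥
  have hsub : (I : Set A) ⊆ ⋃ η ∈ (hfin.toFinset : Set (Ideal A)), (id η : Ideal A) := by
    intro a ha
    rw [Set.Finite.coe_toFinset]
    rw [show (⋃ η ∈ (⊥ : Ideal A).minimalPrimes, ((id η : Ideal A) : Set A)) = _ from
      Ideal.iUnion_minimalPrimes]
    by_contra h1
    refine h a (mem_nonZeroDivisors_iff_right.mpr fun y hy ↦ ?_) ha
    by_contra hy0
    exact h1 ⟨y, by simpa, by simpa [mul_comm] using hy⟩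
  obtain ⟨η, hη, hle⟩ := (Ideal.subset_union_prime ⊥ ⊥ fun η hη _ _ ↦
    (hfin.mem_toFinset.mp hη).1.1).mp hsub
  obtain ⟨a, ha, haI⟩ := hI η (hfin.mem_toFinset.mp hη)
  exact ha (hle haI)

open nonZeroDivisors in
lemma exists_dvd_mul_of_isIntegralFraction {A B : Type*} [CommRing A] [IsReduced A]
    [IsNoetherianRing A] [CommRing B] [IsNoetherianRing B] [Algebra A B] [Algebra.Smooth A B]
    (p : Ideal A) [p.IsMaximal] (x b : B)
    (hx : ∀ b, x * b ∈ p.map (algebraMap A B) → b ∈ p.map (algebraMap A B))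
    (hx0 : x ∈ B⁰) (hb : IsIntegralFraction x b) :
    ∃ r ∈ p.map (algebraMap A B), x ∣ (1 - r) * b := by
  let I : Ideal A := ((Ideal.span {x}).colon {b}).comap (algebraMap A B)
  have hI (a : A) : a ∈ I ↔ x ∣ algebraMap A B a * b := by
    rw [Ideal.mem_comap, Submodule.mem_colon_singleton, Ideal.mem_span_singleton, smul_eq_mul]
  obtain ⟨a, ha, haI⟩ := exists_mem_nonZeroDivisors_of_forall_minimalPrimes I fun η hη ↦ by
    simpa only [hI] using exists_notMem_dvd_mul_of_isIntegralFraction η hη x b hx0 hb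
  obtain ⟨c, hc⟩ := (hI a).mp haI
  obtain ⟨r, hr, d, hd⟩ := exists_mul_mem_span_algebraMap p x hx a c ⟨b, hc.symm⟩
  refine ⟨r, hr, d, ?_⟩
  -- By flatness `a` stays regular on `B`, so it can be cancelled.
  have hreg : IsSMulRegular B (algebraMap A B a) :=
    IsSMulRegular.of_flat (isRegular_iff_mem_nonZeroDivisors.mpr ha).left.isSMulRegular
  apply hreg
  simp only [smul_eq_mul]
  linear_combination (1 - r) * hc + x * hd

/-- Taking `a = 0` above shows that the annihilator of `x` equals `pB` times itself; Nakayama then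
gives one `t` killing all of it. -/
lemma exists_mul_eq_zero_of_mul_eq_zero {A B : Type*} [CommRing A] [CommRing B]
    [Algebra A B] [Module.Flat A B] [IsNoetherianRing B] (p : Ideal A) [p.IsMaximal]
    (x : B) (hx : ∀ b, x * b ∈ p.map (algebraMap A B) → b ∈ p.map (algebraMap A B)) :
    ∃ t : B, t - 1 ∈ p.map (algebraMap A B) ∧ ∀ b, x * b = 0 → t * b = 0 := by
  let N : Ideal B := (⊥ : Ideal B).colon {x}
  have hN (b : B) : b ∈ N ↔ x * b = 0 := by
    rw [Submodule.mem_colon_singleton, Submodule.mem_bot, smul_eq_mul, mul_comm]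
  obtain ⟨t, ht, h⟩ := Submodule.exists_sub_one_mem_and_smul_eq_zero_of_fg_of_le_smul
    (p.map (algebraMap A B)) N (IsNoetherian.noetherian N) fun b hb ↦ by
      obtain ⟨r, hr, hd⟩ := exists_mul_mem_span_algebraMap p x hx 0 b (by simp [(hN b).mp hb])
      rw [map_zero, zero_dvd_iff, sub_mul, one_mul, sub_eq_zero] at hd
      rw [hd]
      exact Submodule.smul_mem_smul hr hb
  exact ⟨t, ht, fun b hb ↦ h b ((hN b).mpr hb)⟩

open nonZeroDivisors in
/-- Let `B` be smooth over the reduced ring `A` and let `x` be regular on a fibre `B / pB`. Elements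
of `B[1/x]` integral over `B` come from `B` in a neighbourhood of that fibre. -/
lemma exists_smul_mem_range_of_isIntegral {A B Bx : Type*} [CommRing A] [IsReduced A]
    [IsNoetherianRing A] [CommRing B] [IsNoetherianRing B] [Algebra A B] [Algebra.Smooth A B]
    (p : Ideal A) [p.IsMaximal] (x : B)
    (hx : ∀ b, x * b ∈ p.map (algebraMap A B) → b ∈ p.map (algebraMap A B))
    [CommRing Bx] [Algebra B Bx] [IsLocalization.Away x Bx] (c : Bx) (hc : IsIntegral B c) :
    ∃ s : B, s - 1 ∈ p.map (algebraMap A B) ∧ ∃ d, algebraMap B Bx s * c = algebraMap B Bx d := by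
  -- `x` may be a zero divisor in `B`; it becomes regular after inverting `t`, which is `1` on the
  -- fibre.
  obtain ⟨t, ht, hann⟩ := exists_mul_eq_zero_of_mul_eq_zero p x hx
  let B₀ := Localization.Away t
  have hpow (n : ℕ) : t ^ n - 1 ∈ p.map (algebraMap A B) := by
    rw [← Ideal.Quotient.eq, map_pow, Ideal.Quotient.eq.mpr ht, map_one, one_pow]
  have : Algebra.Smooth A B₀ := .comp A B B₀
  have hpmap : p.map (algebraMap A B₀) = (p.map (algebraMap A B)).map (algebraMap B B₀) := by
    rw [Ideal.map_map, ← IsScalarTower.algebraMap_eq]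
  have hmem (b : B) (hb : algebraMap B B₀ b ∈ p.map (algebraMap A B₀)) :
      b ∈ p.map (algebraMap A B) := by
    rw [hpmap, IsLocalization.algebraMap_mem_map_algebraMap_iff (Submonoid.powers t)] at hb
    obtain ⟨_, ⟨n, rfl⟩, hn⟩ := hb
    have := sub_mem hn (Ideal.mul_mem_right b _ (hpow n))
    convert this using 1
    ring
  have hpow' (n : ℕ) : IsUnit (algebraMap B B₀ (t ^ n)) :=
    IsLocalization.map_units B₀ (⟨t ^ n, n, rfl⟩ : Submonoid.powers t)
  have hx₀ (b : B₀) (hb : algebraMap B B₀ x * b ∈ p.map (algebraMap A B₀)) :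
      b ∈ p.map (algebraMap A B₀) := by
    obtain ⟨⟨c, _, n, rfl⟩, h⟩ := IsLocalization.surj (Submonoid.powers t) b
    have h1 := hx c (hmem _ (by
      rw [map_mul, ← h, ← mul_assoc]; exact Ideal.mul_mem_right _ _ hb))
    have h2 := Ideal.mem_map_of_mem (algebraMap B B₀) h1
    rw [← hpmap, ← h] at h2
    exact (Ideal.mul_unit_mem_iff_mem _ (hpow' n)).mp h2
  have hreg : algebraMap B B₀ x ∈ B₀⁰ := by
    rw [mem_nonZeroDivisors_iff_right]
    intro b hb
    obtain ⟨⟨c, _, n, rfl⟩, h⟩ := IsLocalization.surj (Submonoid.powers t) b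
    have h1 : algebraMap B B₀ (x * c) = 0 := by
      rw [map_mul, ← h]; linear_combination algebraMap B B₀ (t ^ n) * hb
    obtain ⟨⟨_, k, rfl⟩, hk⟩ := (IsLocalization.map_eq_zero_iff (Submonoid.powers t) _ _).mp h1
    have h2 := hann (t ^ k * c) (by linear_combination hk)
    have h3 : algebraMap B B₀ c = 0 :=
      (IsLocalization.map_eq_zero_iff (Submonoid.powers t) _ _).mpr
        ⟨⟨_, k + 1, rfl⟩, by simp only; linear_combination h2⟩
    rw [h3] at h
    exact (hpow' n).mul_left_eq_zero.mp h
  obtain ⟨⟨b, _, n, rfl⟩, h⟩ := IsLocalization.surj (Submonoid.powers x) c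
  have hint : IsIntegralFraction (algebraMap B B₀ x ^ n) (algebraMap B B₀ b) := by
    let T := Localization.Away (algebraMap B B₀ x)
    have hxu : IsUnit (algebraMap B T x) := by
      rw [IsScalarTower.algebraMap_apply B B₀ T]
      exact IsLocalization.Away.algebraMap_isUnit _
    let g : Bx →ₐ[B] T := IsLocalization.liftAlgHom (M := Submonoid.powers x)
      (f := Algebra.ofId B T) (by rintro ⟨_, n, rfl⟩; simpa using hxu.pow n)
    refine .of_isIntegral (T := T) (c := g c) (IsLocalization.injective (M := .powers _) _
      (Submonoid.powers_le.mpr hreg)) ((hc.map g).tower_top) ?_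
    rw [← map_pow, ← IsScalarTower.algebraMap_apply B B₀ T, ← IsScalarTower.algebraMap_apply B B₀ T,
      ← g.commutes, ← g.commutes, ← map_mul, ← h, mul_comm]
  obtain ⟨r, hr, d, hd⟩ := exists_dvd_mul_of_isIntegralFraction p (algebraMap B B₀ x ^ n) _
    (fun b hb ↦ by
      clear hint h
      induction n with
      | zero => simpa using hb
      | succ n ih => exact ih (hx₀ _ (by convert hb using 1; ring))) (pow_mem hreg n) hint
  obtain ⟨⟨r', _, k, rfl⟩, hr'⟩ := IsLocalization.surj (Submonoid.powers t) r
  obtain ⟨⟨d', _, l, rfl⟩, hd'⟩ := IsLocalization.surj (Submonoid.powers t) d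
  have hrmem : r' ∈ p.map (algebraMap A B) := hmem _ (by
    rw [← hr']; exact Ideal.mul_mem_right _ _ hr)
  have h1 : algebraMap B B₀ (t ^ l * (t ^ k - r') * b) = algebraMap B B₀ (t ^ k * d' * x ^ n) := by
    simp only [map_mul, map_sub, map_pow] at hr' hd' ⊢
    linear_combination (algebraMap B B₀ t ^ l * algebraMap B B₀ b) * hr' +
      algebraMap B B₀ t ^ (l + k) * hd + algebraMap B B₀ t ^ k * algebraMap B B₀ x ^ n * hd'
  obtain ⟨⟨_, j, rfl⟩, hj⟩ := (IsLocalization.eq_iff_exists (Submonoid.powers t) _).mp h1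
  -- Denominators cleared in `hd`: `t ^ k` comes from `r`, `t ^ l` from `d`, and `t ^ j` from
  -- lifting the equality back to `B`.
  refine ⟨t ^ (j + l) * (t ^ k - r'), ?_, t ^ j * t ^ k * d', ?_⟩
  · convert add_mem (Ideal.mul_mem_left _ (t ^ (j + l)) (sub_mem (hpow k) hrmem))
      (hpow (j + l)) using 1
    ring
  · apply (IsLocalization.map_units Bx (⟨x ^ n, n, rfl⟩ : Submonoid.powers x)).mul_right_cancel
    rw [mul_assoc, h, ← map_mul, ← map_mul]
    congr 1
    simp only at hj ⊢
    linear_combination hj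

/-! ### Irreducible fibres and lifting of finite algebras -/

/-- A function on a smooth algebra that does not vanish identically on an irreducible fibre is
regular on that fibre. -/
lemma mem_map_of_mul_mem_of_isIrreducible {A B : Type*} [CommRing A] [CommRing B] [Algebra A B]
    [Algebra.Smooth A B] (p : Ideal A) [p.IsMaximal] (x : B)
    (hirr : IsIrreducible (PrimeSpectrum.comap (algebraMap A B) ⁻¹' {⟨p, inferInstance⟩}))
    (z : PrimeSpectrum B) (hz : PrimeSpectrum.comap (algebraMap A B) z = ⟨p, inferInstance⟩)
    (hxz : x ∉ z.asIdeal) (b : B) (hb : x * b ∈ p.map (algebraMap A B)) :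
    b ∈ p.map (algebraMap A B) := by
  let _ := Ideal.Quotient.field p
  have hpre : PrimeSpectrum.comap (algebraMap A B) ⁻¹' {⟨p, inferInstance⟩} =
      PrimeSpectrum.zeroLocus (p.map (algebraMap A B) : Set B) := by
    ext w
    rw [Set.mem_preimage, Set.mem_singleton_iff, PrimeSpectrum.mem_zeroLocus, SetLike.coe_subset_coe,
      Ideal.map_le_iff_le_comap, PrimeSpectrum.ext_iff]
    exact ⟨fun h ↦ h.ge, fun h ↦ ((‹p.IsMaximal›).eq_of_le (w.comap _).2.ne_top h).symm⟩
  rw [hpre, PrimeSpectrum.isIrreducible_zeroLocus_iff] at hirr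
  have hzle : z ∈ PrimeSpectrum.zeroLocus (p.map (algebraMap A B) : Set B) := by
    rw [← hpre]; exact hz
  rw [PrimeSpectrum.mem_zeroLocus, SetLike.coe_subset_coe] at hzle
  -- The fibre ring is smooth over the field `A ⧸ p`, hence reduced; with irreducibility this makes
  -- `pB` prime.
  have hred : (p.map (algebraMap A B)).IsRadical := by
    have h1 := (isReduced_and_dvd_of_isIntegralFraction_of_smooth (A ⧸ p)
      (TensorProduct A (A ⧸ p) B)).1
    have := isReduced_of_injective
      ((Algebra.TensorProduct.comm A B (A ⧸ p)).toRingHom.comp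
        (Algebra.TensorProduct.quotIdealMapEquivTensorQuot B p).toRingHom)
      ((Algebra.TensorProduct.comm A B (A ⧸ p)).injective.comp
        (Algebra.TensorProduct.quotIdealMapEquivTensorQuot B p).injective)
    exact (Ideal.isRadical_iff_quotient_reduced _).mpr this
  rw [hred.radical] at hirr
  exact (hirr.mem_or_mem hb).resolve_left fun h ↦ hxz (hzle h)

/-- Finitely many generators of `C` need finitely many denominators `s c`. Their product, times an
element killing the annihilator of `x`, is still `1` modulo `pB`. -/
lemma exists_lift_away {A B Bx C : Type*} [CommRing A] [IsReduced A]
    [IsNoetherianRing A] [CommRing B] [IsNoetherianRing B] [Algebra A B] [Algebra.Smooth A B]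
    (p : Ideal A) [p.IsMaximal] (x : B)
    (hx : ∀ b, x * b ∈ p.map (algebraMap A B) → b ∈ p.map (algebraMap A B))
    [CommRing Bx] [Algebra B Bx] [IsLocalization.Away x Bx] [CommRing C] [Algebra B C]
    [Module.Finite B C] (ψ : C →ₐ[B] Bx) :
    ∃ t : B, t - 1 ∈ p.map (algebraMap A B) ∧
      ∀ (Bt Btx : Type u) [CommRing Bt] [CommRing Btx] [Algebra B Bt] [Algebra B Btx] [Algebra Bt Btx]
        [IsScalarTower B Bt Btx] [IsLocalization.Away t Bt] [IsLocalization.Away (t * x) Btx]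
        (g : Bx →ₐ[B] Btx), Function.Injective (algebraMap Bt Btx) ∧
          ∃ f : C →ₐ[B] Bt, ∀ c, algebraMap Bt Btx (f c) = g (ψ c) := by
  classical
  obtain ⟨t₀, ht₀, hann⟩ := exists_mul_eq_zero_of_mul_eq_zero p x hx
  obtain ⟨G, hG⟩ := Algebra.FiniteType.out (R := B) (A := C)
  choose s hs d hd using fun c : C ↦ exists_smul_mem_range_of_isIntegral p x hx (ψ c)
    ((Algebra.IsIntegral.isIntegral (R := B) c).map ψ)
  have hmod (b : B) : b - 1 ∈ p.map (algebraMap A B) ↔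
      Ideal.Quotient.mk (p.map (algebraMap A B)) b = 1 := by
    rw [← Ideal.Quotient.eq, map_one]
  refine ⟨t₀ * ∏ c ∈ G, s c, ?_, ?_⟩
  · rw [hmod, map_mul, (hmod _).mp ht₀, one_mul, map_prod]
    exact Finset.prod_eq_one fun c _ ↦ (hmod _).mp (hs c)
  intro Bt Btx _ _ _ _ _ _ _ _ g
  set t := t₀ * ∏ c ∈ G, s c with ht
  have hinj : Function.Injective (algebraMap Bt Btx) := by
    rw [injective_iff_map_eq_zero]
    intro b hb
    obtain ⟨⟨b₀, _, n, rfl⟩, h⟩ := IsLocalization.surj (Submonoid.powers t) b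
    have h1 : algebraMap B Btx b₀ = 0 := by
      rw [IsScalarTower.algebraMap_apply B Bt Btx, ← h, map_mul, hb, zero_mul]
    obtain ⟨⟨_, m, rfl⟩, hm⟩ := (IsLocalization.map_eq_zero_iff (Submonoid.powers (t * x)) _ _).mp h1
    have h2 : ∀ m : ℕ, ∀ b, x ^ m * b = 0 → t ^ m * b = 0 := by
      intro m
      induction m with
      | zero => simp
      | succ m ih =>
        intro b hb
        have := ih (x * b) (by rw [← mul_assoc, ← pow_succ, hb])
        have := hann (t ^ m * b) (by rw [mul_left_comm, this])
        rw [pow_succ', mul_assoc, ht, mul_right_comm, this, zero_mul]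
    have h3 := h2 m (t ^ m * b₀) (by simp only at hm; linear_combination hm)
    have h4 : algebraMap B Bt b₀ = 0 :=
      (IsLocalization.map_eq_zero_iff (Submonoid.powers t) _ _).mpr
        ⟨⟨_, m + m, rfl⟩, by simp only; linear_combination h3⟩
    rw [h4] at h
    exact (IsLocalization.map_units Bt (⟨t ^ n, n, rfl⟩ : Submonoid.powers t)).mul_left_eq_zero.mp h
  let i : Bt →ₐ[B] Btx := IsScalarTower.toAlgHom B Bt Btx
  have hrange : (g.comp ψ).range ≤ i.range := by
    rw [← Algebra.map_top, ← hG, AlgHom.map_adjoin, Algebra.adjoin_le_iff]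
    rintro _ ⟨c, hc, rfl⟩
    have hu : IsUnit (algebraMap B Bt (s c)) :=
      isUnit_of_dvd_unit (map_dvd _ ((Finset.dvd_prod_of_mem s hc).mul_left _))
        (IsLocalization.Away.algebraMap_isUnit t)
    obtain ⟨v, hv⟩ := hu.dvd (a := algebraMap B Bt (d c))
    refine ⟨v, (hu.map i).mul_left_cancel ?_⟩
    have h1 := congrArg g (hd c)
    rw [map_mul, g.commutes, g.commutes] at h1
    change i _ * i v = i _ * g (ψ c)
    rw [← map_mul, ← hv, i.commutes, i.commutes, h1]
  let e := AlgEquiv.ofInjective i hinj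
  refine ⟨hinj, (e.symm : _ →ₐ[B] Bt).comp ((g.comp ψ).codRestrict i.range
    fun c ↦ hrange ⟨c, rfl⟩), fun c ↦ ?_⟩
  exact congrArg Subtype.val (e.apply_symm_apply _)

/-! ### From algebra to local sections of schemes -/

lemma exists_affine_nhds_of_isFinite_morphismRestrict {X Y S : Scheme.{u}} (f : X ⟶ Y) (h : Y ⟶ S)
    (y : Y) (V₁ : Y.Opens) (hy : y ∈ V₁) [IsFinite (f ∣_ V₁)] :
    ∃ (W : S.Opens) (V : Y.Opens), IsAffineOpen W ∧ IsAffineOpen V ∧ h y ∈ W ∧ y ∈ V ∧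
      V ≤ h ⁻¹ᵁ W ∧ IsAffineOpen (f ⁻¹ᵁ V) ∧ (f.app V).hom.Finite := by
  obtain ⟨_, ⟨W, hW, rfl⟩, hyW, -⟩ := S.isBasis_affineOpens.exists_subset_of_mem_open
    (Set.mem_univ (h y)) isOpen_univ
  obtain ⟨_, ⟨V, hV, rfl⟩, hyV, hVle⟩ := (V₁ : Scheme.{u}).isBasis_affineOpens.exists_subset_of_mem_open
    (show (⟨y, hy⟩ : V₁) ∈ V₁.ι ⁻¹ᵁ (h ⁻¹ᵁ W) from hyW) (V₁.ι ⁻¹ᵁ (h ⁻¹ᵁ W)).isOpen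
  have hVaff : IsAffineOpen (V₁.ι ''ᵁ V) := hV.image_of_isOpenImmersion V₁.ι
  have heq : (f ⁻¹ᵁ V₁).ι ''ᵁ (f ∣_ V₁) ⁻¹ᵁ V = f ⁻¹ᵁ V₁.ι ''ᵁ V :=
    image_morphismRestrict_preimage f V₁ V
  refine ⟨W, V₁.ι ''ᵁ V, hW, hVaff, hyW, ⟨⟨y, hy⟩, hyV, rfl⟩, ?_, ?_, ?_⟩
  · rintro _ ⟨v, hv, rfl⟩
    exact hVle hv
  · rw [← heq]
    exact (hV.preimage (f ∣_ V₁)).image_of_isOpenImmersion _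
  · have h1 : (f.app (V₁.ι ''ᵁ V) ≫ X.presheaf.map (eqToHom heq).op).hom.Finite := by
      have := IsFinite.finite_app (f ∣_ V₁) V hV
      rwa [morphismRestrict_app] at this
    have h3 : f.app (V₁.ι ''ᵁ V) = (f.app (V₁.ι ''ᵁ V) ≫ X.presheaf.map (eqToHom heq).op) ≫
        X.presheaf.map (eqToHom heq.symm).op := by
      rw [Category.assoc, ← Functor.map_comp, ← op_comp, eqToHom_trans]
      simp
    have hsurj : Function.Surjective (X.presheaf.map (eqToHom heq.symm).op) :=
      (ConcreteCategory.bijective_of_isIso _).2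
    rw [h3]
    exact (RingHom.Finite.of_surjective _ hsurj).comp h1

lemma AlgebraicGeometry.IsAffineOpen.mem_basicOpen_iff_notMem_primeIdealOf {X : Scheme.{u}} {U : X.Opens}
    (hU : IsAffineOpen U) (x : U) (f : Γ(X, U)) :
    (x : X) ∈ X.basicOpen f ↔ f ∉ (hU.primeIdealOf x).asIdeal := by
  rw [← PrimeSpectrum.mem_basicOpen]
  rw [← hU.fromSpec_preimage_basicOpen, ← hU.fromSpec_primeIdealOf x]
  rfl

/-- Restriction of a morphism with irreducible fibre over `h y` to affine opens. -/
lemma isIrreducible_comap_appLE_preimage {Y S : Scheme.{u}} (h : Y ⟶ S) {W : S.Opens} {V : Y.Opens}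
    (hW : IsAffineOpen W) (hV : IsAffineOpen V) (e : V ≤ h ⁻¹ᵁ W) (s : W)
    (hirr : IsIrreducible (h ⁻¹' {(s : S)})) (hne : ((V : Set Y) ∩ h ⁻¹' {(s : S)}).Nonempty) :
    IsIrreducible (PrimeSpectrum.comap (h.appLE W V e).hom ⁻¹' {hW.primeIdealOf s}) := by
  have heq : PrimeSpectrum.comap (h.appLE W V e).hom ⁻¹' {hW.primeIdealOf s} =
      hV.fromSpec ⁻¹' (h ⁻¹' {(s : S)}) := by
    ext z
    have h1 : hW.fromSpec (PrimeSpectrum.comap (h.appLE W V e).hom z) = h (hV.fromSpec z) :=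
      congrArg (fun g ↦ g z) (IsAffineOpen.SpecMap_appLE_fromSpec h hW hV e)
    refine ⟨fun hz ↦ h1.symm.trans ((congrArg hW.fromSpec hz).trans (hW.fromSpec_primeIdealOf s)),
      fun hz ↦ hW.fromSpec.isOpenEmbedding.injective
        (h1.trans (Eq.trans hz (hW.fromSpec_primeIdealOf s).symm))⟩
  rw [heq]
  obtain ⟨v, hv, hvs⟩ := hne
  refine ⟨⟨hV.primeIdealOf ⟨v, hv⟩, ?_⟩, hirr.2.preimage hV.fromSpec.isOpenEmbedding⟩
  exact (congrArg h (hV.fromSpec_primeIdealOf ⟨v, hv⟩)).trans hvs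

/-- The section `j` over `U` is extended, as `τ`, across `y`. The two are compared only on `T`, the
basic open of `t * x`; dominance of `b` is what later upgrades this to agreement on all of `U ∩ V`.
-/
lemma exists_dominant_extension {X Y S : Scheme.{u}} [IsReduced S] [IsLocallyNoetherian S]
    [IsLocallyNoetherian Y] (h : Y ⟶ S) [Smooth h] (U : Y.Opens) (f : X ⟶ Y)
    (j : (U : Scheme.{u}) ⟶ X) (hj : j ≫ f = U.ι) (y : Y) (hs : IsClosed {h y})
    (hirr : IsIrreducible (h ⁻¹' {h y})) (hne : ((U : Set Y) ∩ h ⁻¹' {h y}).Nonempty)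
    (V₁ : Y.Opens) (hyV₁ : y ∈ V₁) [IsFinite (f ∣_ V₁)] :
    ∃ V : Y.Opens, y ∈ V ∧ ∃ τ : (V : Scheme.{u}) ⟶ X, τ ≫ f = V.ι ∧
      ∃ (T : Scheme.{u}) (a : T ⟶ U) (b : T ⟶ V), IsDominant b ∧ a ≫ U.ι = b ≫ V.ι ∧
        a ≫ j = b ≫ τ := by
  obtain ⟨W, V, hW, hV, hyW, hyV, hVW, hQ, hfin⟩ :=
    exists_affine_nhds_of_isFinite_morphismRestrict f h y V₁ hyV₁
  -- `y` itself may lie outside `U`, so irreducibility supplies another point `z` of its fibre in `U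
  -- ∩ V`, and `x` is chosen not to vanish at `z`.
  obtain ⟨z, hzs, hzV, hzU⟩ := hirr.2 V U V.isOpen U.isOpen ⟨y, rfl, hyV⟩
    (by rwa [Set.inter_comm] at hne)
  obtain ⟨x, hxU, hzx⟩ := hV.exists_basicOpen_le ⟨z, hzU⟩ hzV
  let p := (hW.primeIdealOf ⟨h y, hyW⟩).asIdeal
  have hp : p.IsMaximal := hW.primeIdealOf_isMaximal_of_isClosed _ hs
  let _ : Algebra Γ(S, W) Γ(Y, V) := (h.appLE W V hVW).hom.toAlgebra
  have : Algebra.Smooth Γ(S, W) Γ(Y, V) := h.smooth_appLE hW hV hVW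
  have : IsNoetherianRing Γ(S, W) := IsLocallyNoetherian.component_noetherian ⟨W, hW⟩
  have : IsNoetherianRing Γ(Y, V) := IsLocallyNoetherian.component_noetherian ⟨V, hV⟩
  have hcomap (z : Y) (hz : z ∈ V) (hzs : h z = h y) :
      (hV.primeIdealOf ⟨z, hz⟩).comap (h.appLE W V hVW).hom = hW.primeIdealOf ⟨h y, hyW⟩ := by
    rw [IsAffineOpen.comap_primeIdealOf_appLE W hW V hV hVW hz]
    congr 1
    exact Subtype.ext hzs
  have hxreg := mem_map_of_mul_mem_of_isIrreducible p x
    (isIrreducible_comap_appLE_preimage h hW hV hVW ⟨h y, hyW⟩ hirr ⟨y, hyV, rfl⟩)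
    (hV.primeIdealOf ⟨z, hzV⟩) (hcomap z hzV hzs)
    ((hV.mem_basicOpen_iff_notMem_primeIdealOf ⟨z, hzV⟩ x).mp hzx)
  have hDx := hV.basicOpen x
  have := hV.isLocalization_basicOpen x
  let ax : Spec Γ(Y, Y.basicOpen x) ⟶ U := IsOpenImmersion.lift U.ι hDx.fromSpec
    (by rw [hDx.range_fromSpec, Scheme.Opens.range_ι]; exact hxU)
  have hax : ax ≫ U.ι = hDx.fromSpec := IsOpenImmersion.lift_fac _ _ _
  have haf : ax ≫ j ≫ f = hDx.fromSpec := by rw [hj, hax]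
  let l : Spec Γ(Y, Y.basicOpen x) ⟶ Spec Γ(X, f ⁻¹ᵁ V) := IsOpenImmersion.lift hQ.fromSpec (ax ≫ j)
    (by
      rw [hQ.range_fromSpec]
      rintro _ ⟨w, rfl⟩
      have h1 : f ((ax ≫ j) w) = hDx.fromSpec w := congrArg (fun g ↦ g w) haf
      change f ((ax ≫ j) w) ∈ V
      rw [h1]
      exact Y.basicOpen_le x (hDx.range_fromSpec.le ⟨w, rfl⟩))
  let ψ : Γ(X, f ⁻¹ᵁ V) ⟶ Γ(Y, Y.basicOpen x) := Spec.preimage l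
  have hψ : Spec.map ψ ≫ hQ.fromSpec = ax ≫ j := by
    rw [Spec.map_preimage]; exact IsOpenImmersion.lift_fac _ _ _
  have hfQ : Spec.map (f.app V) ≫ hV.fromSpec = hQ.fromSpec ≫ f := by
    rw [← IsAffineOpen.SpecMap_appLE_fromSpec f hV hQ le_rfl, Scheme.Hom.app_eq_appLE]
  have hfψ : f.app V ≫ ψ = Y.presheaf.map (homOfLE (Y.basicOpen_le x)).op := by
    apply Spec.map_injective
    rw [← cancel_mono hV.fromSpec, Spec.map_comp, Category.assoc, hfQ, reassoc_of% hψ, haf,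
      IsAffineOpen.map_fromSpec]
  let _ : Algebra Γ(Y, V) Γ(X, f ⁻¹ᵁ V) := (f.app V).hom.toAlgebra
  have : Module.Finite Γ(Y, V) Γ(X, f ⁻¹ᵁ V) := hfin
  let ψ' : Γ(X, f ⁻¹ᵁ V) →ₐ[Γ(Y, V)] Γ(Y, Y.basicOpen x) :=
    { ψ.hom with commutes' := fun b ↦ congrArg (fun g ↦ g.hom b) hfψ }
  obtain ⟨t, htp, ht⟩ := exists_lift_away p x hxreg ψ'
  have hDt := hV.basicOpen t
  have hDtx := hV.basicOpen (t * x)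
  have := hV.isLocalization_basicOpen t
  have := hV.isLocalization_basicOpen (t * x)
  have hle : Y.basicOpen (t * x) ≤ Y.basicOpen t := by
    rw [Scheme.basicOpen_mul]; exact inf_le_left
  have hle' : Y.basicOpen (t * x) ≤ Y.basicOpen x := by
    rw [Scheme.basicOpen_mul]; exact inf_le_right
  let rt := Y.presheaf.map (homOfLE hle).op
  let rx := Y.presheaf.map (homOfLE hle').op
  let _ : Algebra Γ(Y, Y.basicOpen t) Γ(Y, Y.basicOpen (t * x)) := rt.hom.toAlgebra
  have : IsScalarTower Γ(Y, V) Γ(Y, Y.basicOpen t) Γ(Y, Y.basicOpen (t * x)) := by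
    refine IsScalarTower.of_algebraMap_eq fun b ↦ ?_
    refine congrArg (fun g ↦ g.hom b) (show Y.presheaf.map (homOfLE (Y.basicOpen_le (t * x))).op =
      Y.presheaf.map (homOfLE (Y.basicOpen_le t)).op ≫ rt from ?_)
    rw [← Functor.map_comp]; rfl
  let g : Γ(Y, Y.basicOpen x) →ₐ[Γ(Y, V)] Γ(Y, Y.basicOpen (t * x)) :=
    { rx.hom with
      commutes' := fun b ↦ congrArg (fun g ↦ g.hom b)
        (show Y.presheaf.map (homOfLE (Y.basicOpen_le x)).op ≫ rx =
          Y.presheaf.map (homOfLE (Y.basicOpen_le (t * x))).op by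
          rw [← Functor.map_comp]; rfl) }
  obtain ⟨hinj, F, hF⟩ := ht Γ(Y, Y.basicOpen t) Γ(Y, Y.basicOpen (t * x)) g
  let F' : Γ(X, f ⁻¹ᵁ V) ⟶ Γ(Y, Y.basicOpen t) := CommRingCat.ofHom F.toRingHom
  have hFf : f.app V ≫ F' = Y.presheaf.map (homOfLE (Y.basicOpen_le t)).op := by
    ext b; exact F.commutes b
  have hFψ : F' ≫ rt = ψ ≫ rx := by
    ext c; exact hF c
  have hcomm : Spec.map rt ≫ Spec.map F' ≫ hQ.fromSpec = Spec.map rx ≫ ax ≫ j := by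
    rw [← Spec.map_comp_assoc, hFψ, Spec.map_comp_assoc, hψ]
  refine ⟨Y.basicOpen t, ?_, hDt.isoSpec.hom ≫ Spec.map F' ≫ hQ.fromSpec, ?_,
    Spec Γ(Y, Y.basicOpen (t * x)), Spec.map rx ≫ ax, Spec.map rt ≫ hDt.isoSpec.inv, ?_, ?_, ?_⟩
  · rw [hV.mem_basicOpen_iff_notMem_primeIdealOf ⟨y, hyV⟩]
    intro hmem
    -- `y` lies over `p` and `t - 1 ∈ pB`, so `t` takes the value `1` at `y`.
    have h1 : p.map (algebraMap Γ(S, W) Γ(Y, V)) ≤ (hV.primeIdealOf ⟨y, hyV⟩).asIdeal :=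
      Ideal.map_le_iff_le_comap.mpr (congrArg PrimeSpectrum.asIdeal (hcomap y hyV rfl)).ge
    refine (hV.primeIdealOf ⟨y, hyV⟩).2.ne_top ((Ideal.eq_top_iff_one _).mpr ?_)
    simpa using sub_mem hmem (h1 htp)
  · rw [Category.assoc, Category.assoc, ← hfQ, ← Spec.map_comp_assoc, hFf,
      IsAffineOpen.map_fromSpec _ hDt, hDt.isoSpec_hom_fromSpec]
  · have : IsDominant (Spec.map rt) := by
      constructor
      exact (PrimeSpectrum.denseRange_comap_iff_ker_le_nilRadical rt.hom).mpr
        ((RingHom.injective_iff_ker_eq_bot _).mp hinj ▸ bot_le)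
    infer_instance
  · rw [Category.assoc, Category.assoc, hax, IsAffineOpen.map_fromSpec _ hDtx,
      ← hDt.isoSpec_hom_fromSpec, Iso.inv_hom_id_assoc, IsAffineOpen.map_fromSpec _ hDtx]
  · rw [Category.assoc, Category.assoc, Iso.inv_hom_id_assoc, hcomm]

/-! ### Gluing, density and the main theorem -/

lemma isDominant_pullback_snd_of_isOpenImmersion {U A Y : Scheme.{u}} (i : U ⟶ Y) (e : A ⟶ Y)
    [IsDominant i] [IsOpenImmersion e] : IsDominant (pullback.snd i e) := by
  constructor
  rw [DenseRange, Scheme.Pullback.range_snd]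
  exact i.denseRange.preimage e.isOpenEmbedding.isOpenMap

/-- Two morphisms to a separated `S`-scheme, defined on open subschemes `U` and `V` of a reduced
scheme, agree on `U ∩ V` if they agree on a scheme that maps dominantly to `V`. -/
lemma pullback_fst_comp_eq_of_isDominant {Y S P T : Scheme.{u}} [IsReduced Y] (h : Y ⟶ S)
    (p : P ⟶ S) [IsSeparated p] (U V : Y.Opens) (φ : (U : Scheme.{u}) ⟶ P)
    (ψ : (V : Scheme.{u}) ⟶ P) (hφ : φ ≫ p = U.ι ≫ h) (hψ : ψ ≫ p = V.ι ≫ h)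
    (a : T ⟶ U) (b : T ⟶ V) [IsDominant b] (hab : a ≫ U.ι = b ≫ V.ι) (heq : a ≫ φ = b ≫ ψ) :
    pullback.fst U.ι V.ι ≫ φ = pullback.snd U.ι V.ι ≫ ψ := by
  have : IsReduced (pullback U.ι V.ι) := isReduced_of_isOpenImmersion (pullback.fst U.ι V.ι)
  have : IsDominant (pullback.lift a b hab ≫ pullback.snd U.ι V.ι) := by
    rwa [pullback.lift_snd]
  have : IsDominant (pullback.lift a b hab) :=
    IsDominant.of_comp_of_isOpenImmersion _ (pullback.snd U.ι V.ι)
  refine ext_of_isDominant_of_isSeparated p ?_ (pullback.lift a b hab) ?_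
  · rw [Category.assoc, Category.assoc, hφ, hψ, pullback.condition_assoc]
  · rw [pullback.lift_fst_assoc, pullback.lift_snd_assoc, heq]

/-- Gluing of local extensions of a morphism defined on a dense open subscheme. -/
lemma exists_extension_of_local {Y S P : Scheme.{u}} [IsReduced Y] (h : Y ⟶ S)
    (p : P ⟶ S) [IsSeparated p] (U : Y.Opens) [IsDominant U.ι] (φ : (U : Scheme.{u}) ⟶ P)
    {I : Type u} (V : I → Y.Opens) (hV : TopologicalSpace.IsOpenCover V)
    (ψ : ∀ i, (V i : Scheme.{u}) ⟶ P) (hψ : ∀ i, ψ i ≫ p = (V i).ι ≫ h)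
    (hag : ∀ i, pullback.fst U.ι (V i).ι ≫ φ = pullback.snd U.ι (V i).ι ≫ ψ i) :
    ∃ φ' : Y ⟶ P, φ' ≫ p = h ∧ U.ι ≫ φ' = φ := by
  let 𝒱 := Y.openCoverOfIsOpenCover V hV
  have hT (i : I) {T : Scheme.{u}} (a : T ⟶ U) (b : T ⟶ V i) (hab : a ≫ U.ι = b ≫ (V i).ι) :
      a ≫ φ = b ≫ ψ i := by
    have := congrArg (pullback.lift a b hab ≫ ·) (hag i)
    simpa only [pullback.lift_fst_assoc, pullback.lift_snd_assoc] using this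
  -- Both maps restrict to `φ` on the part of `V i ∩ V j` inside `U`, which is dense there.
  have hcompat (i j : I) :
      pullback.fst (V i).ι (V j).ι ≫ ψ i = pullback.snd (V i).ι (V j).ι ≫ ψ j := by
    have : IsReduced (pullback (V i).ι (V j).ι) :=
      isReduced_of_isOpenImmersion (pullback.fst (V i).ι (V j).ι)
    let e := pullback.fst (V i).ι (V j).ι ≫ (V i).ι
    have := isDominant_pullback_snd_of_isOpenImmersion U.ι e
    refine ext_of_isDominant_of_isSeparated p ?_ (pullback.snd U.ι e) ?_
    · rw [Category.assoc, Category.assoc, hψ, hψ, pullback.condition_assoc]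
    · rw [← Category.assoc, ← Category.assoc, ← hT i (pullback.fst U.ι e),
        ← hT j (pullback.fst U.ι e)]
      · have he : e = pullback.snd (V i).ι (V j).ι ≫ (V j).ι := pullback.condition
        rw [pullback.condition, he, Category.assoc]
      · rw [pullback.condition, Category.assoc]
  let φ' : Y ⟶ P := 𝒱.glueMorphisms ψ hcompat
  have hφ' (i : I) : (V i).ι ≫ φ' = ψ i := 𝒱.ι_glueMorphisms _ _ i
  have hover (i : I) : (V i).ι ≫ φ' ≫ p = (V i).ι ≫ h := by
    rw [reassoc_of% hφ', hψ]
  have hext (i : I) : pullback.fst U.ι (V i).ι ≫ U.ι ≫ φ' = pullback.fst U.ι (V i).ι ≫ φ := by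
    rw [pullback.condition_assoc, hφ', hag]
  exact ⟨φ', Scheme.Cover.hom_ext 𝒱 _ _ hover,
    Scheme.Cover.hom_ext (𝒱.pullback₁ U.ι) _ _ hext⟩

/-- A nonempty open set contains a closed point, whose image is closed in `S`. The irreducible fibre
through it meets both that open set and `U`, hence their intersection. -/
lemma dense_of_forall_closed_fiber {Y S : Scheme.{u}} [JacobsonSpace Y] [JacobsonSpace S] (h : Y ⟶ S)
    [LocallyOfFiniteType h] (U : Y.Opens)
    (hirr : ∀ s : S, IsClosed {s} → s ∈ Set.range h → IsIrreducible (h ⁻¹' {s}))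
    (hU : ∀ s : S, IsClosed {s} → s ∈ Set.range h → ((U : Set Y) ∩ h ⁻¹' {s}).Nonempty) :
    Dense (U : Set Y) := by
  rw [dense_iff_inter_open]
  intro O hO hne
  obtain ⟨y, hyO, hy⟩ := nonempty_inter_closedPoints hne hO.isLocallyClosed
  have hs : IsClosed {h y} := h.closePoints_subset_preimage_closedPoints hy
  obtain ⟨z, hz, hzU⟩ := hU _ hs ⟨y, rfl⟩
  obtain ⟨w, -, hw⟩ := (hirr _ hs ⟨y, rfl⟩).2 O U hO U.isOpen ⟨y, rfl, hyO⟩ ⟨z, hzU, hz⟩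
  exact ⟨w, hw⟩

lemma range_imageι_subset_closure {X Y : Scheme.{u}} (f : X ⟶ Y) [QuasiCompact f] :
    Set.range f.imageι ⊆ closure (Set.range f) := by
  rintro _ ⟨x, rfl⟩
  have h1 := image_closure_subset_closure_image f.imageι.continuous
    ⟨x, f.toImage.denseRange x, rfl⟩
  have h2 : f.imageι ∘ f.toImage = f := by
    ext x
    rw [Function.comp_apply, ← Scheme.Hom.comp_apply, f.toImage_imageι]
  rwa [← Set.range_comp, h2] at h1

theorem theorem2 (k : Type u) [Field k] [IsAlgClosed k] (Y S P : Scheme.{u})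
    (πY : Y ⟶ Spec (CommRingCat.of k)) (πS : S ⟶ Spec (CommRingCat.of k))
    (πP : P ⟶ Spec (CommRingCat.of k))
    (hY : IsVariety k Y πY) (hS : IsVariety k S πS) (hP : IsVariety k P πP)
    (d : ℕ) (hd : 1 ≤ d)
    (h : Y ⟶ S) (hk : h ≫ πS = πY) (h_smooth : Smooth h)
    (h_fibers : ∀ s : S, IsClosed {s} → s ∈ Set.range h →
      IsIrreducible (h ⁻¹' {s}) ∧ topologicalKrullDim ↥(h ⁻¹' {s}) = d)
    (p : P ⟶ S) (pk : p ≫ πS = πP) (p_proper : IsProper p)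
    (U : Y.Opens)
    (hU : ∀ s : S, IsClosed {s} → s ∈ Set.range h → ((U : Set Y) ∩ h ⁻¹' {s}).Nonempty)
    (φ : (U : Scheme.{u}) ⟶ P) (hφ : φ ≫ p = U.ι ≫ h)
    (h_fin : ∀ y : Y, IsClosed {y} → y ∉ U →
      (graphClosure h p U φ hφ ∩ pullback.fst h p ⁻¹' {y}).Finite) :
    ∃! φ' : Y ⟶ P, φ' ≫ p = h ∧ U.ι ≫ φ' = φ := by
  obtain ⟨_, _, _, _⟩ := hY
  obtain ⟨_, _, _, _⟩ := hS
  have : JacobsonSpace Y := LocallyOfFiniteType.jacobsonSpace πY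
  have : JacobsonSpace S := LocallyOfFiniteType.jacobsonSpace πS
  have : IsLocallyNoetherian Y := LocallyOfFiniteType.isLocallyNoetherian πY
  have : IsLocallyNoetherian S := LocallyOfFiniteType.isLocallyNoetherian πS
  have hirr := fun s hs hsr ↦ (h_fibers s hs hsr).1
  have : IsDominant U.ι := Opens.isDominant_ι (dense_of_forall_closed_fiber h U hirr hU)
  refine existsUnique_of_exists_of_unique ?_ fun φ₁ φ₂ h₁ h₂ ↦
    ext_of_isDominant_of_isSeparated p (h₁.1.trans h₂.1.symm) U.ι (h₁.2.trans h₂.2.symm)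
  let γ := graphHom h p U φ hφ
  have hγ₁ : γ ≫ pullback.fst h p = U.ι := pullback.lift_fst _ _ _
  have hγ₂ : γ ≫ pullback.snd h p = φ := pullback.lift_snd _ _ _
  -- Quasi-compactness keeps the scheme-theoretic image of `γ`, used as `X`, inside the topological
  -- closure of the graph, where `h_fin` applies.
  have : QuasiCompact γ := by
    have : QuasiCompact (γ ≫ pullback.fst h p) := by rw [hγ₁]; infer_instance
    exact .of_comp _ (pullback.fst h p)
  let f := γ.imageι ≫ pullback.fst h p
  have hloc (y : Y) (hy : IsClosed {y}) : ∃ V : Y.Opens, y ∈ V ∧ ∃ ψ : (V : Scheme.{u}) ⟶ P,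
      ψ ≫ p = V.ι ≫ h ∧ pullback.fst U.ι V.ι ≫ φ = pullback.snd U.ι V.ι ≫ ψ := by
    by_cases hyU : y ∈ U
    · refine ⟨U, hyU, φ, hφ, ?_⟩
      rw [(cancel_mono U.ι).mp (pullback.condition (f := U.ι) (g := U.ι))]
    have hfib : (f ⁻¹' {y}).Finite := by
      refine .of_finite_image (f := γ.imageι) ((h_fin y hy hyU).subset ?_)
        γ.imageι.isClosedEmbedding.injective.injOn
      rintro _ ⟨x, hx, rfl⟩
      exact ⟨range_imageι_subset_closure γ ⟨x, rfl⟩, hx⟩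
    -- `f` is a closed immersion followed by a base change of `p`, hence proper; a proper map with
    -- finite fibre is finite nearby.
    obtain ⟨V₁, hyV₁, _⟩ := exists_isFinite_morphismRestrict_of_finite_preimage_singleton f y hfib
    have hs : IsClosed {h y} := h.closePoints_subset_preimage_closedPoints hy
    obtain ⟨V, hyV, τ, hτ, T, a, b, _, hab, hT⟩ := exists_dominant_extension h U f γ.toImage
      (by rw [γ.toImage_imageι_assoc, hγ₁]) y hs (hirr _ hs ⟨y, rfl⟩) (hU _ hs ⟨y, rfl⟩) V₁ hyV₁
    have hψ : (τ ≫ γ.imageι ≫ pullback.snd h p) ≫ p = V.ι ≫ h := by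
      rw [← hτ]; simp only [f, Category.assoc, pullback.condition]
    refine ⟨V, hyV, τ ≫ γ.imageι ≫ pullback.snd h p, hψ,
      pullback_fst_comp_eq_of_isDominant h p U V _ _ hφ hψ a b hab ?_⟩
    rw [← reassoc_of% hT, γ.toImage_imageι_assoc, hγ₂]
  choose V hyV ψ hψ hag using hloc
  refine exists_extension_of_local h p U φ (fun y : closedPoints Y ↦ V y y.2) ?_
    (fun y ↦ ψ y y.2) (fun y ↦ hψ y y.2) fun y ↦ hag y y.2
  rw [TopologicalSpace.IsOpenCover]
  by_contra hne
  have hne' : ((⨆ y : closedPoints Y, V y y.2 : Y.Opens) : Set Y)ᶜ.Nonempty := by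
    rw [Set.nonempty_compl]
    exact fun h ↦ hne (TopologicalSpace.Opens.ext h)
  -- Neighbourhoods of closed points suffice: in a Jacobson space a nonempty closed set contains a
  -- closed point.
  obtain ⟨y, hy, hyc⟩ := nonempty_inter_closedPoints hne'
    (TopologicalSpace.Opens.isOpen _).isClosed_compl.isLocallyClosed
  exact hy (TopologicalSpace.Opens.mem_iSup.mpr ⟨⟨y, hyc⟩, hyV y hyc⟩)
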